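/- Let $A$ be an alphabet, and let $\Xi$ be a set of three unknowns. A (coefficient-free) word equation $E: u=v$ on $\Xi$ consists of two words $u,v\in\Xi^*$; it is trivial if $u$ and $v$ are the same word. A solution of $E$ is a morphism $h:\Xi^*\to A^*$ with $h(u)=h(v)$, and a solution of a system is a common solution of all its equations; $\mathrm{Sol}(\cdot)$ denotes the set of all solutions. For $x\in\Xi$ let $|E|_x$ be the number of occurrences of $x$ in the word $uv$. The rank of a morphism $h:\Xi^*\to A^*$ is the least number $r$ for which there is a set $S\subseteq A^*$ of $r$ words with $h(x)\in S^*$ for every unknown $x$; $h$ is periodic if its rank is at most $1$. A system $E_1,\dots,E_m$ is independent if it is not equivalent to (does not have the same solutions as) any of its proper subsystems. A sequence $E_1,\dots,E_m$ of nontrivial equations is a chain if $$\mathrm{Sol}(E_1)\supsetneq \mathrm{Sol}(E_1,E_2)\supsetneq\dots\supsetneq\mathrm{Sol}(E_1,\dots,E_m).$$ Let $m\ge 1$ and let $E_1,\dots,E_m$ be word equations on the three unknowns $\Xi$. 1. If $E_1,\dots,E_m$ is an independent system that has a nonperiodic solution, then there are two distinct unknowns $x,y\in\Xi$ such that $m\le(|E_1|_x+|E_1|_y)^2+1$.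 2. If $E_1,\dots,E_m$ is a chain, then there are two distinct unknowns $x,y\in\Xi$ such that $m\le(|E_1|_x+|E_1|_y)^2+5$. -/

import Mathlib

namespace WordEq

/-- A (coefficient-free) word equation `lhs = rhs` with unknowns in `X`. -/
structure Equation (X : Type*) where
  lhs : FreeMonoid X
  rhs : FreeMonoid X

/-- The equation is trivial if its two sides are the same word. -/
def Equation.IsTrivial {X : Type*} (E : Equation X) : Prop :=
  E.lhs = E.rhs

/-- The number of occurrences of the unknown `x` in the equation, on both sides together. -/
def Equation.occ {X : Type*} [DecidableEq X] (E : Equation X) (x : X) : ℕ :=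
  (E.lhs * E.rhs).toList.count x

/-- The solutions of an equation over the alphabet `A`. -/
def Equation.sol {X : Type*} (A : Type*) (E : Equation X) :
    Set (FreeMonoid X →* FreeMonoid A) :=
  {h | h E.lhs = h E.rhs}

/-- The common solutions over `A` of the equations `E i` with `i ∈ I`
(all morphisms, if `I` is empty). -/
def sysSol {X ι : Type*} (A : Type*) (E : ι → Equation X) (I : Set ι) :
    Set (FreeMonoid X →* FreeMonoid A) :=
  {h | ∀ i ∈ I, h ∈ (E i).sol A}

/-- The combinatorial rank of a morphism: the least size of a set `S` of words such that
the image of every unknown is a product of words of `S`. -/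
noncomputable def rank {X A : Type*} (h : FreeMonoid X →* FreeMonoid A) : ℕ∞ :=
  ⨅ (S : Set (FreeMonoid A)) (_ : ∀ x : X, h (FreeMonoid.of x) ∈ Submonoid.closure S), S.encard

/-- A morphism is periodic if its rank is at most one. -/
def IsPeriodic {X A : Type*} (h : FreeMonoid X →* FreeMonoid A) : Prop :=
  rank h ≤ 1

/-- The system is not equivalent (over the alphabet `A`) to any of its proper subsystems. -/
def IsIndependent {X ι : Type*} (A : Type*) (E : ι → Equation X) : Prop :=
  ∀ I : Set ι, I ⊂ Set.univ → sysSol A E I ≠ sysSol A E Set.univ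

/-- All equations are nontrivial, and the solution sets (over the alphabet `A`) of the initial
subsystems form a strictly decreasing sequence. -/
def IsChain {X : Type*} (A : Type*) {m : ℕ} (E : Fin m → Equation X) : Prop :=
  (∀ i, ¬ (E i).IsTrivial) ∧ StrictAnti (fun i : Fin m => sysSol A E (Set.Iic i))

end WordEq

/-! The proof linearizes word equations by Fox calculus. To an equation one attaches the vector of
differences of the abelianized Fox derivatives of its sides, over the polynomial ring in the
unknowns. The chain rule `fox_hom` and the injectivity statement `eq_of_fox_eq` show that `g` solves
an equation exactly when this vector, pushed forward along the Parikh matrix of `g`, is orthogonal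
to the Fox derivatives of the images (`map_lhs_eq_map_rhs_iff`).

By `exists_parikhMinor_ne_zero`, a nonperiodic solution of a nontrivial equation can be replaced,
without changing which equations it solves, by a morphism into a two-letter monoid whose Parikh
matrix has rank two. With three unknowns the orthogonality conditions then leave a single line. So a
solution of a nontrivial `E` solves `F` iff all pushed-forward 2×2 minors of the pair `E`, `F`
vanish. This depends only on the kernel of the Parikh matrix, itself a rational line
(`map_eq_of_common_kernel`).

If a minor is nonzero before being pushed forward, its monomials lie in n = |E|_x + |E|_y pairs of
chains, each translating the occurrences of a letter in `F` by one occurrence in `E`. After a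
push-forward to zero, the lexicographically least monomials must cancel, and on each chain only its
first monomial of the relevant sign matters. Hence one of n² differences of exponents spans the
kernel (`exists_cover`), and at most n² common nonperiodic solutions of `E`, `F` are pairwise
distinguishable (`card_le_of_distinguished`).

Independence and chains supply distinguishable solutions. Periodic ones obey linear equations: they
do not occur in the independent case and number at most three in a chain. -/

namespace WordEq

/-! ### Abelianized Fox derivatives of words -/

section Fox

open AddMonoidAlgebra

variable {X Y M N : Type*}

/-- The total weight of a word. -/
def weight [AddMonoid M] (w : X → M) (u : List X) : M :=
  (u.map w).sum

@[simp] lemma weight_nil [AddMonoid M] (w : X → M) : weight w [] = 0 := rfl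

@[simp] lemma weight_cons [AddMonoid M] (w : X → M) (a : X) (u : List X) :
    weight w (a :: u) = w a + weight w u := by
  simp [weight]

lemma weight_append [AddMonoid M] (w : X → M) (u v : List X) :
    weight w (u ++ v) = weight w u + weight w v := by
  simp [weight]

variable [DecidableEq X] [DecidableEq Y] [AddCommMonoid M] [AddCommMonoid N]

/-- The abelianized Fox derivative of a word with respect to the letter `x`: the sum over all
occurrences of `x` of the monomial whose exponent is the weight of the prefix before it. -/
noncomputable def fox (w : X → M) (x : X) : List X → AddMonoidAlgebra ℤ M
  | [] => 0
  | a :: u => (if a = x then 1 else 0) + single (w a) 1 * fox w x u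

@[simp] lemma fox_nil (w : X → M) (x : X) : fox w x [] = 0 := rfl

lemma fox_cons (w : X → M) (x a : X) (u : List X) :
    fox w x (a :: u) = (if a = x then 1 else 0) + single (w a) 1 * fox w x u := rfl

lemma fox_append (w : X → M) (x : X) (u v : List X) :
    fox w x (u ++ v) = fox w x u + single (weight w u) 1 * fox w x v := by
  induction u with
  | nil => simp [← one_def]
  | cons a u ih =>
    have h : single (w a + weight w u) (1 : ℤ) = single (w a) 1 * single (weight w u) 1 := by
      simp
    simp only [List.cons_append, fox_cons, ih, weight_cons, h]
    ring

lemma mapDomainRingHom_fox (G : M →+ N) (w : X → M) (x : X) (u : List X) :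
    mapDomainRingHom ℤ G (fox w x u) = fox (fun a => G (w a)) x u := by
  induction u with
  | nil => simp
  | cons a u ih =>
    rw [fox_cons, fox_cons, map_add, map_mul, ih]
    congr 1
    · split_ifs <;> simp
    · simp

/-- Chain rule: every occurrence of `c` in the image of `u` lies inside the image of one letter
occurrence of `u`, translated by the weight of what precedes it. -/
lemma fox_hom [Fintype X] (w : Y → M) (c : Y) (g : FreeMonoid X →* FreeMonoid Y) (u : List X) :
    fox w c (g (FreeMonoid.ofList u)).toList =
      ∑ x, fox (fun a => weight w (g (FreeMonoid.of a)).toList) x u *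
        fox w c (g (FreeMonoid.of x)).toList := by
  induction u with
  | nil => simp
  | cons a u ih =>
    simp only [FreeMonoid.ofList_cons, map_mul, FreeMonoid.toList_mul, fox_append, ih, fox_cons,
      add_mul, Finset.sum_add_distrib, ite_mul, one_mul, zero_mul, Finset.sum_ite_eq,
      Finset.mem_univ, if_true, Finset.mul_sum, mul_assoc]

/-- Setting every monomial to 1 forgets positions, so Fox minors specialize to Parikh minors. -/
lemma sum_coeff_fox (x : X) (u : List X) (w : X → M) :
    AddMonoidAlgebra.lift ℤ ℤ M 1 (fox w x u) = u.count x := by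
  induction u with
  | nil => simp
  | cons a u ih =>
    rw [fox_cons, map_add, map_mul, ih, List.count_cons]
    by_cases h : a = x <;> simp [h, add_comm]

lemma fox_coeff_nonneg (w : X → M) (x : X) (u : List X) (m : M) : 0 ≤ (fox w x u).coeff m := by
  induction u generalizing m with
  | nil => simp
  | cons a u ih =>
    rw [fox_cons, coeff_add, Finsupp.add_apply]
    refine add_nonneg ?_ ?_
    · split_ifs
      · rw [one_def, coeff_single]
        classical
        rw [Finsupp.single_apply]
        split_ifs <;> simp
      · simp
    · classical
      rw [coeff_mul]
      refine Finset.sum_nonneg fun i _ => Finset.sum_nonneg fun j _ => ?_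
      dsimp only
      split_ifs
      · refine mul_nonneg ?_ (ih j)
        rw [coeff_single, Finsupp.single_apply]
        split_ifs <;> simp
      · simp

end Fox

/-! ### Recovering a word from its Fox derivatives -/

section Injective

open AddMonoidAlgebra

variable {X M : Type*} [DecidableEq X] [AddCommMonoid M] [PartialOrder M] [CanonicallyOrderedAdd M]

lemma coeff_zero_fox_cons_self (w : X → M) (a : X) (u : List X) :
    1 ≤ (fox w a (a :: u)).coeff 0 := by
  rw [fox_cons, if_pos rfl, coeff_add, Finsupp.add_apply, one_def, coeff_single,
    Finsupp.single_eq_same]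
  have : 0 ≤ (single (w a) (1 : ℤ) * fox w a u).coeff 0 := by
    by_cases h : w a = 0
    · simpa [h, ← one_def] using fox_coeff_nonneg w a u 0
    · rw [coeff_single_mul_of_forall_add_ne]
      intro d hd
      exact h (by have := add_eq_zero.1 hd; exact this.1)
  omega

lemma coeff_zero_fox_cons_of_ne (w : X → M) {a b : X} (hab : a ≠ b) (hb : w b ≠ 0) (u : List X) :
    (fox w a (b :: u)).coeff 0 = 0 := by
  rw [fox_cons, if_neg (Ne.symm hab), zero_add, coeff_single_mul_of_forall_add_ne]
  intro d hd
  exact hb (add_eq_zero.1 hd).1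

/-- A word is determined by its Fox derivatives if at most one letter has weight zero. -/
lemma eq_of_fox_eq [IsCancelAdd M] (w : X → M) (hw : ∀ a b, w a = 0 → w b = 0 → a = b) {u v : List X}
    (h : ∀ x, fox w x u = fox w x v) : u = v := by
  induction u generalizing v with
  | nil =>
    cases v with
    | nil => rfl
    | cons b v =>
      have h1 := coeff_zero_fox_cons_self w b v
      rw [← h b] at h1
      simp at h1
  | cons a u ih =>
    cases v with
    | nil =>
      have h1 := coeff_zero_fox_cons_self w a u
      rw [h a] at h1
      simp at h1
    | cons b v =>
      by_cases hab : a = b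
      · subst hab
        rw [ih (v := v)]
        intro x
        have h1 := h x
        rw [fox_cons, fox_cons, add_right_inj] at h1
        ext m
        have h2 := congrArg (fun f => f.coeff (w a + m)) h1
        simpa using h2
      · exfalso
        -- The constant term of a derivative detects a first letter provided the competing first
        -- letter has nonzero weight. Since `a` and `b` cannot both have weight zero, one of the two
        -- comparisons applies.
        by_cases hb : w b = 0
        · have ha : w a ≠ 0 := fun ha => hab (hw a b ha hb)
          have h1 := coeff_zero_fox_cons_self w b v
          rw [← h b, coeff_zero_fox_cons_of_ne w (Ne.symm hab) ha] at h1
          omega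
        · have h1 := coeff_zero_fox_cons_self w a u
          rw [h a, coeff_zero_fox_cons_of_ne w hab hb] at h1
          omega

end Injective

/-! ### Combinatorics of words and elementary morphisms -/

section Words

variable {X A : Type*}

open FreeMonoid

lemma isPeriodic_iff (h : FreeMonoid X →* FreeMonoid A) :
    IsPeriodic h ↔ ∃ w, ∀ x, h (of x) ∈ Submonoid.powers w := by
  constructor
  · intro hp
    have h2 : rank h < 2 := lt_of_le_of_lt hp (by norm_num)
    simp only [rank, iInf_lt_iff] at h2
    obtain ⟨S, hS, hc⟩ := h2
    have h1 : S.encard ≤ 1 := by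
      have : (2 : ℕ∞) = 1 + 1 := by norm_num
      rw [this] at hc
      exact Order.lt_add_one_iff_of_not_isMax (by simp) |>.1 hc
    rw [Set.encard_le_one_iff_subsingleton] at h1
    rcases h1.eq_empty_or_singleton with rfl | ⟨w, rfl⟩
    · refine ⟨1, fun x => ?_⟩
      have := hS x
      rw [Submonoid.closure_empty, Submonoid.mem_bot] at this
      rw [this]
      exact one_mem _
    · refine ⟨w, fun x => ?_⟩
      rw [Submonoid.powers_eq_closure]
      exact hS x
  · rintro ⟨w, hw⟩
    refine (iInf₂_le {w} fun x => ?_).trans (by simp)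
    rw [← Submonoid.powers_eq_closure]
    exact hw x

/-- If two products agree then one of the left factors is a prefix of the other. -/
lemma exists_eq_mul_or {a b c d : FreeMonoid A} (h : a * c = b * d) :
    (∃ e, a = b * e) ∨ ∃ e, b = a * e := by
  have h1 : a.toList <+: (a * c).toList := ⟨c.toList, rfl⟩
  have h2 : b.toList <+: (a * c).toList := ⟨d.toList, by rw [h]; rfl⟩
  rcases List.prefix_or_prefix_of_prefix h1 h2 with ⟨e, he⟩ | ⟨e, he⟩
  · exact Or.inr ⟨ofList e, he.symm⟩
  · exact Or.inl ⟨ofList e, he.symm⟩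

/-- Euclidean algorithm on lengths: the shorter word is a prefix of the longer one, and cancelling
it preserves commutation. -/
lemma exists_powers_of_commute {a b : FreeMonoid A} (h : a * b = b * a) :
    ∃ w, a ∈ Submonoid.powers w ∧ b ∈ Submonoid.powers w := by
  induction hn : a.length + b.length using Nat.strong_induction_on generalizing a b with
  | _ n ih =>
  by_cases ha : a = 1
  · exact ⟨b, ha ▸ one_mem _, Submonoid.mem_powers b⟩
  by_cases hb : b = 1
  · exact ⟨a, Submonoid.mem_powers a, hb ▸ one_mem _⟩
  have ha' : a.length ≠ 0 := by simpa using ha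
  have hb' : b.length ≠ 0 := by simpa using hb
  rcases exists_eq_mul_or h with ⟨e, rfl⟩ | ⟨e, rfl⟩
  · rw [mul_assoc, mul_right_inj] at h
    rw [length_mul] at hn
    obtain ⟨w, h1, h2⟩ := ih (e.length + b.length) (by omega) h rfl
    exact ⟨w, mul_mem h2 h1, h2⟩
  · rw [mul_assoc, mul_right_inj] at h
    rw [length_mul] at hn
    obtain ⟨w, h1, h2⟩ := ih (a.length + e.length) (by omega) h rfl
    exact ⟨w, h1, mul_mem h1 h2⟩

lemma of_mul_inj {x y : X} {u v : FreeMonoid X} : of x * u = of y * v ↔ x = y ∧ u = v :=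
  List.cons_eq_cons

variable [DecidableEq X]

/-- The elementary endomorphism `a ↦ b a`, fixing all other letters. -/
def elementary (a b : X) : FreeMonoid X →* FreeMonoid X :=
  lift fun x => if x = a then of b * of a else of x

lemma elementary_of_self (a b : X) : elementary a b (of a) = of b * of a := by
  simp [elementary]

lemma elementary_of_of_ne {a x : X} (b : X) (h : x ≠ a) : elementary a b (of x) = of x := by
  simp [elementary, h]

/-- In an image every `a` is preceded by an inserted `b`; this makes decoding unique. -/
lemma elementary_ne_of_mul {a b : X} (hab : a ≠ b) (u t : FreeMonoid X) :
    elementary a b u ≠ of a * t := by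
  cases u using FreeMonoid.casesOn with
  | one => intro h; exact absurd (congrArg toList h) (by simp)
  | of_mul x u =>
    intro h
    have h := congrArg toList h
    rw [map_mul] at h
    by_cases hx : x = a
    · subst hx
      rw [elementary_of_self] at h
      simp only [toList_mul, toList_of, List.cons_append, List.nil_append, List.cons.injEq] at h
      exact hab h.1.symm
    · rw [elementary_of_of_ne b hx] at h
      simp only [toList_mul, toList_of, List.cons_append, List.nil_append, List.cons.injEq] at h
      exact hx h.1

lemma elementary_injective {a b : X} (hab : a ≠ b) : Function.Injective (elementary a b) := by
  intro u
  induction u using FreeMonoid.inductionOn' with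
  | one =>
    intro v h
    cases v using FreeMonoid.casesOn with
    | one => rfl
    | of_mul y v =>
      exfalso
      rw [map_mul, map_one] at h
      by_cases hy : y = a
      · subst hy
        rw [elementary_of_self, mul_assoc] at h
        exact absurd (congrArg toList h) (by simp)
      · rw [elementary_of_of_ne b hy] at h
        exact absurd (congrArg toList h) (by simp)
  | of_mul x u ih =>
    intro v h
    cases v using FreeMonoid.casesOn with
    | one =>
      exfalso
      rw [map_mul, map_one] at h
      by_cases hy : x = a
      · subst hy
        rw [elementary_of_self, mul_assoc] at h
        exact absurd (congrArg toList h) (by simp)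
      · rw [elementary_of_of_ne b hy] at h
        exact absurd (congrArg toList h) (by simp)
    | of_mul y v =>
      rw [map_mul, map_mul] at h
      by_cases hxy : x = y
      · subst hxy
        rw [ih (mul_left_cancel h)]
      · exfalso
        by_cases hx : x = a
        · subst hx
          rw [elementary_of_self, elementary_of_of_ne b (Ne.symm hxy), mul_assoc, of_mul_inj] at h
          exact elementary_ne_of_mul hab _ _ h.2.symm
        · rw [elementary_of_of_ne b hx] at h
          by_cases hy : y = a
          · subst hy
            rw [elementary_of_self, mul_assoc, of_mul_inj] at h
            exact elementary_ne_of_mul hab _ _ h.2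
          · rw [elementary_of_of_ne b hy, of_mul_inj] at h
            exact hxy h.1

/-- A noninjective morphism that erases no letter factors through an elementary endomorphism. -/
lemma exists_eq_mul_of_not_injective {h : FreeMonoid X →* FreeMonoid A}
    (hne : ∀ x, h (of x) ≠ 1) {u v : FreeMonoid X} (huv : u ≠ v) (he : h u = h v) :
    ∃ a b w, a ≠ b ∧ h (of a) = h (of b) * w := by
  have key : ∀ x t, h (of x * t) ≠ 1 := by
    intro x t ht
    rw [map_mul] at ht
    have := congrArg length ht
    rw [length_mul, length_one] at this
    exact hne x (length_eq_zero.1 (by omega))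
  induction u using FreeMonoid.inductionOn' generalizing v with
  | one =>
    cases v using FreeMonoid.casesOn with
    | one => exact absurd rfl huv
    | of_mul y v => exact absurd (by rw [← he, map_one]) (key y v)
  | of_mul x u ih =>
    cases v using FreeMonoid.casesOn with
    | one => exact absurd (by rw [he, map_one]) (key x u)
    | of_mul y v =>
      by_cases hxy : x = y
      · subst hxy
        rw [map_mul, map_mul] at he
        exact ih (fun h => huv (by rw [h])) (mul_left_cancel he)
      · rw [map_mul, map_mul] at he
        rcases exists_eq_mul_or he with ⟨e, h1⟩ | ⟨e, h1⟩
        · exact ⟨x, y, e, hxy, h1⟩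
        · exact ⟨y, x, e, Ne.symm hxy, h1⟩

/-- The morphism agreeing with `h` except that `a` is sent to `w`. -/
def updateHom (h : FreeMonoid X →* FreeMonoid A) (a : X) (w : FreeMonoid A) :
    FreeMonoid X →* FreeMonoid A :=
  lift (Function.update (fun x => h (of x)) a w)

lemma updateHom_of_self (h : FreeMonoid X →* FreeMonoid A) (a : X) (w : FreeMonoid A) :
    updateHom h a w (of a) = w := by
  simp [updateHom]

lemma updateHom_of_of_ne (h : FreeMonoid X →* FreeMonoid A) {a x : X} (w : FreeMonoid A)
    (hx : x ≠ a) : updateHom h a w (of x) = h (of x) := by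
  simp [updateHom, hx]

lemma updateHom_elementary {h : FreeMonoid X →* FreeMonoid A} {a b : X} {w : FreeMonoid A}
    (hab : a ≠ b) (hw : h (of a) = h (of b) * w) (u : FreeMonoid X) :
    updateHom h a w (elementary a b u) = h u := by
  have : (updateHom h a w).comp (elementary a b) = h := by
    refine hom_eq fun x => ?_
    by_cases hx : x = a
    · subst hx
      simp [elementary_of_self, updateHom_of_self, updateHom_of_of_ne h w (Ne.symm hab), hw]
    · simp [elementary_of_of_ne b hx, updateHom_of_of_ne h w hx]
  exact congrArg (fun f : FreeMonoid X →* FreeMonoid A => f u) this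

lemma sum_length_updateHom_lt [Fintype X] {h : FreeMonoid X →* FreeMonoid A} {a b : X}
    {w : FreeMonoid A} (hb : h (of b) ≠ 1) (hw : h (of a) = h (of b) * w) :
    ∑ x, (updateHom h a w (of x)).length < ∑ x, (h (of x)).length := by
  have hb' : (h (of b)).length ≠ 0 := by simpa using hb
  have ha : (updateHom h a w (of a)).length < (h (of a)).length := by
    rw [updateHom_of_self, hw, length_mul]
    omega
  refine Finset.sum_lt_sum (fun x _ => ?_) ⟨a, Finset.mem_univ a, ha⟩
  by_cases hx : x = a
  · exact hx ▸ ha.le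
  · rw [updateHom_of_of_ne h w hx]

/-- Two words that satisfy a nontrivial relation commute. -/
lemma commute_of_not_injective {h : FreeMonoid (Fin 2) →* FreeMonoid A} {u v : FreeMonoid (Fin 2)}
    (huv : u ≠ v) (he : h u = h v) (i j : Fin 2) : Commute (h (of i)) (h (of j)) := by
  induction hn : ∑ x, (h (of x)).length using Nat.strong_induction_on generalizing h u v i j with
  | _ n ih =>
  subst hn
  by_cases hne : ∀ x, h (of x) ≠ 1
  · obtain ⟨a, b, w, hab, hw⟩ := exists_eq_mul_of_not_injective hne huv he
    have h1 := ih _ (sum_length_updateHom_lt (hne b) hw)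
      (fun h => huv (elementary_injective hab h))
      (by rw [updateHom_elementary hab hw, updateHom_elementary hab hw, he]) a b rfl
    rw [updateHom_of_self, updateHom_of_of_ne h w (Ne.symm hab)] at h1
    have h2 : Commute (h (of a)) (h (of b)) := by
      rw [hw]
      exact (Commute.refl _).mul_left h1
    have hcases : ∀ x : Fin 2, x = a ∨ x = b := fun x => by omega
    rcases hcases i with rfl | rfl <;> rcases hcases j with rfl | rfl
    · exact Commute.refl _
    · exact h2
    · exact h2.symm
    · exact Commute.refl _
  · push Not at hne
    obtain ⟨x, hx⟩ := hne
    have : i = j ∨ i = x ∨ j = x := by omega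
    rcases this with rfl | rfl | rfl
    · exact Commute.refl _
    · rw [hx]
      exact Commute.one_left _
    · rw [hx]
      exact Commute.one_right _

end Words

/-! ### Reduction to morphisms of Parikh rank two -/

section Parikh

open FreeMonoid

variable {X Y A : Type*} [DecidableEq Y]

/-- The Parikh vectors of the images of the letters. -/
def parikh (g : FreeMonoid X →* FreeMonoid Y) (x : X) : Y → ℕ :=
  weight (fun c => Pi.single c 1) (g (of x)).toList

/-- The minors of the Parikh matrix of a morphism into a two-letter monoid. -/
def parikhMinor (g : FreeMonoid X →* FreeMonoid (Fin 2)) (x y : X) : ℤ :=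
  parikh g x 0 * parikh g y 1 - parikh g y 0 * parikh g x 1

lemma parikh_comp_elementary_self [DecidableEq X] (g : FreeMonoid X →* FreeMonoid Y) (a b : X) :
    parikh (g.comp (elementary a b)) a = parikh g b + parikh g a := by
  simp [parikh, elementary_of_self, weight_append]

lemma parikh_comp_elementary_of_ne [DecidableEq X] (g : FreeMonoid X →* FreeMonoid Y)
    {a x : X} (b : X) (h : x ≠ a) : parikh (g.comp (elementary a b)) x = parikh g x := by
  simp [parikh, elementary_of_of_ne b h]

/-- Precomposition with an elementary morphism adds column `b` of the Parikh matrix to column `a`,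
an operation that preserves the rank. -/
lemma exists_parikhMinor_comp_elementary [DecidableEq X] {g : FreeMonoid X →* FreeMonoid (Fin 2)}
    {a b : X} (hab : a ≠ b) (hg : ∃ x y, parikhMinor g x y ≠ 0) :
    ∃ x y, parikhMinor (g.comp (elementary a b)) x y ≠ 0 := by
  by_contra! hcon
  obtain ⟨x, y, hxy⟩ := hg
  apply hxy
  have h1 : ∀ z, z ≠ a → parikhMinor g a z = 0 := by
    intro z hz
    have h2 := hcon a z
    have h3 := hcon b z
    simp only [parikhMinor, parikh_comp_elementary_self, parikh_comp_elementary_of_ne g b hz,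
      parikh_comp_elementary_of_ne g b (Ne.symm hab), Pi.add_apply, Nat.cast_add] at h2 h3 ⊢
    linear_combination h2 - h3
  by_cases hx : x = a
  · subst hx
    by_cases hy : y = x
    · subst hy
      simp [parikhMinor]
    · exact h1 y hy
  · by_cases hy : y = a
    · subst hy
      have := h1 x hx
      simp only [parikhMinor] at this ⊢
      linear_combination -this
    · have := hcon x y
      simpa only [parikhMinor, parikh_comp_elementary_of_ne g b hx,
        parikh_comp_elementary_of_ne g b hy] using this

/-- A nonperiodic morphism that erases a letter satisfies the same relations as a morphism
renaming the two remaining letters. -/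
lemma exists_parikhMinor_ne_zero_of_erasing {h : FreeMonoid (Fin 3) →* FreeMonoid A}
    (hp : ¬ IsPeriodic h) {x : Fin 3} (hx : h (of x) = 1) :
    ∃ g : FreeMonoid (Fin 3) →* FreeMonoid (Fin 2), (∀ u v, h u = h v ↔ g u = g v) ∧
      ∃ y z, parikhMinor g y z ≠ 0 := by
  obtain ⟨y, z, hyz, hyx, hzx, hall⟩ : ∃ y z : Fin 3, y ≠ z ∧ y ≠ x ∧ z ≠ x ∧
      ∀ t, t = x ∨ t = y ∨ t = z := by
    clear hx
    revert x
    decide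
  let g : FreeMonoid (Fin 3) →* FreeMonoid (Fin 2) :=
    lift fun t => if t = x then 1 else if t = y then of 0 else of 1
  let θ : FreeMonoid (Fin 2) →* FreeMonoid A := lift ![h (of y), h (of z)]
  have hgx : g (of x) = 1 := by simp [g]
  have hgy : g (of y) = of 0 := by simp [g, hyx]
  have hgz : g (of z) = of 1 := by simp [g, hzx, Ne.symm hyz]
  have hθ : ∀ u, θ (g u) = h u := by
    intro u
    have : θ.comp g = h := by
      refine hom_eq fun t => ?_
      rcases hall t with rfl | rfl | rfl
      · simp [hgx, hx]
      · simp [hgy, θ]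
      · simp [hgz, θ]
    exact congrArg (fun f : FreeMonoid (Fin 3) →* FreeMonoid A => f u) this
  refine ⟨g, fun u v => ⟨fun huv => ?_, fun huv => by rw [← hθ, ← hθ, huv]⟩, y, z, ?_⟩
  -- A relation lost by `g` would make the two surviving images commute, hence be powers of one
  -- word, and `h` would be periodic.
  · by_contra hne
    rw [← hθ, ← hθ] at huv
    have hc := commute_of_not_injective hne huv 0 1
    have h0 : θ (of 0) = h (of y) := by simp [θ]
    have h1 : θ (of 1) = h (of z) := by simp [θ]
    rw [h0, h1] at hc
    obtain ⟨w, hy, hz⟩ := exists_powers_of_commute hc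
    refine hp ((isPeriodic_iff h).2 ⟨w, fun t => ?_⟩)
    rcases hall t with rfl | rfl | rfl
    · rw [hx]
      exact one_mem _
    · exact hy
    · exact hz
  · simp [parikhMinor, parikh, hgy, hgz]

/-- A nonperiodic morphism satisfying a nontrivial relation satisfies the same relations as some
morphism into a two-letter monoid whose Parikh matrix has rank two. -/
lemma exists_parikhMinor_ne_zero {h : FreeMonoid (Fin 3) →* FreeMonoid A} (hp : ¬ IsPeriodic h)
    {u v : FreeMonoid (Fin 3)} (huv : u ≠ v) (he : h u = h v) :
    ∃ g : FreeMonoid (Fin 3) →* FreeMonoid (Fin 2), (∀ u v, h u = h v ↔ g u = g v) ∧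
      ∃ y z, parikhMinor g y z ≠ 0 := by
  induction hn : ∑ x, (h (of x)).length using Nat.strong_induction_on generalizing h u v with
  | _ n ih =>
  subst hn
  by_cases hne : ∀ x, h (of x) ≠ 1
  · obtain ⟨a, b, w, hab, hw⟩ := exists_eq_mul_of_not_injective hne huv he
    have hcomp := updateHom_elementary hab hw
    obtain ⟨g, hg, hm⟩ := ih _ (sum_length_updateHom_lt (hne b) hw) (h := updateHom h a w)
      (by
        intro hp'
        obtain ⟨t, ht⟩ := (isPeriodic_iff _).1 hp'
        refine hp ((isPeriodic_iff h).2 ⟨t, fun x => ?_⟩)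
        by_cases hx : x = a
        · subst hx
          rw [← hcomp, elementary_of_self, map_mul]
          exact mul_mem (ht _) (ht _)
        · rw [← hcomp, elementary_of_of_ne b hx]
          exact ht _)
      (fun h => huv (elementary_injective hab h)) (by rw [hcomp, hcomp, he]) rfl
    refine ⟨g.comp (elementary a b), fun u v => ?_, exists_parikhMinor_comp_elementary hab hm⟩
    rw [MonoidHom.comp_apply, MonoidHom.comp_apply, ← hg, hcomp, hcomp]
  · push Not at hne
    obtain ⟨x, hx⟩ := hne
    exact exists_parikhMinor_ne_zero_of_erasing hp hx

end Parikh

/-! ### Orthogonality in rank three over a domain -/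

section LinearAlgebra

variable {R : Type*} [CommRing R] [IsDomain R]

/-- Vectors of a three-dimensional space orthogonal to two independent vectors are parallel. -/
lemma mul_eq_mul_of_orthogonal {p p' q q' : Fin 3 → R} (hp : ∃ i j, p i * p' j - p j * p' i ≠ 0)
    (h1 : ∑ x, q x * p x = 0) (h2 : ∑ x, q x * p' x = 0)
    (h3 : ∑ x, q' x * p x = 0) (h4 : ∑ x, q' x * p' x = 0) (i j : Fin 3) :
    q i * q' j = q j * q' i := by
  -- The cross product of `p` and `p'`: every vector orthogonal to both is parallel to it.
  let c : Fin 3 → R := ![p 1 * p' 2 - p 2 * p' 1, p 2 * p' 0 - p 0 * p' 2, p 0 * p' 1 - p 1 * p' 0]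
  obtain ⟨k, hk⟩ : ∃ k, c k ≠ 0 := by
    by_contra! hc
    obtain ⟨i, j, hij⟩ := hp
    apply hij
    have h0 : p 1 * p' 2 - p 2 * p' 1 = 0 := hc 0
    have h1 : p 2 * p' 0 - p 0 * p' 2 = 0 := hc 1
    have h2 : p 0 * p' 1 - p 1 * p' 0 = 0 := hc 2
    fin_cases i <;> fin_cases j <;>
      simp only [Fin.isValue, Fin.zero_eta, Fin.mk_one, Fin.reduceFinMk] <;>
      first
        | ring1
        | linear_combination h0
        | linear_combination h1
        | linear_combination h2
        | linear_combination -h0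
        | linear_combination -h1
        | linear_combination -h2
  have key : ∀ r : Fin 3 → R, ∑ x, r x * p x = 0 → ∑ x, r x * p' x = 0 →
      ∀ a b, c a * r b = c b * r a := by
    intro r hr hr'
    rw [Fin.sum_univ_three] at hr hr'
    have e01 : c 0 * r 1 = c 1 * r 0 := by
      change (p 1 * p' 2 - p 2 * p' 1) * r 1 = (p 2 * p' 0 - p 0 * p' 2) * r 0
      linear_combination p' 2 * hr - p 2 * hr'
    have e12 : c 1 * r 2 = c 2 * r 1 := by
      change (p 2 * p' 0 - p 0 * p' 2) * r 2 = (p 0 * p' 1 - p 1 * p' 0) * r 1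
      linear_combination p' 0 * hr - p 0 * hr'
    have e20 : c 2 * r 0 = c 0 * r 2 := by
      change (p 0 * p' 1 - p 1 * p' 0) * r 0 = (p 1 * p' 2 - p 2 * p' 1) * r 2
      linear_combination p' 1 * hr - p 1 * hr'
    intro a b
    fin_cases a <;> fin_cases b <;>
      first
        | rfl
        | exact e01
        | exact e12
        | exact e20
        | exact e01.symm
        | exact e12.symm
        | exact e20.symm
  have hq := key q h1 h2
  have hq' := key q' h3 h4
  have : c k ^ 2 * (q i * q' j - q j * q' i) = 0 := by
    linear_combination c k * q' j * hq k i + c i * q k * hq' k j - c k * q' i * hq k j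
      - c j * q k * hq' k i
  exact sub_eq_zero.1 ((mul_eq_zero.1 this).resolve_left (pow_ne_zero 2 hk))

lemma sum_mul_eq_zero_of_parallel {X : Type*} [Fintype X] {p q q' : X → R} {k : X} (hk : q k ≠ 0)
    (h : ∀ i j, q i * q' j = q j * q' i) (hq : ∑ x, q x * p x = 0) : ∑ x, q' x * p x = 0 := by
  have : q k * ∑ x, q' x * p x = q' k * ∑ x, q x * p x := by
    rw [Finset.mul_sum, Finset.mul_sum]
    refine Finset.sum_congr rfl fun x _ => ?_
    linear_combination p x * h k x
  rw [hq, mul_zero] at this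
  exact (mul_eq_zero.1 this).resolve_left hk

end LinearAlgebra

/-! ### Solutions as vanishing of minors -/

section Solutions

open FreeMonoid AddMonoidAlgebra

variable {X Y M N : Type*} [DecidableEq Y]

/-- The action of a morphism on Parikh vectors. -/
def parikhHom [Fintype X] (g : FreeMonoid X →* FreeMonoid Y) : (X → ℕ) →+ (Y → ℕ) where
  toFun v := ∑ x, v x • parikh g x
  map_zero' := by simp
  map_add' u v := by simp [add_smul, Finset.sum_add_distrib]

lemma parikhHom_apply [Fintype X] (g : FreeMonoid X →* FreeMonoid Y) (v : X → ℕ) (c : Y) :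
    parikhHom g v c = ∑ x, v x * parikh g x c := by
  simp [parikhHom]

lemma parikh_apply (g : FreeMonoid X →* FreeMonoid Y) (x : X) (c : Y) :
    parikh g x c = (g (of x)).toList.count c := by
  rw [parikh]
  induction (g (of x)).toList with
  | nil => simp
  | cons a u ih =>
    rw [weight_cons, Pi.add_apply, ih, List.count_cons, add_comm, Pi.single_apply]
    simp only [eq_comm (a := c), beq_iff_eq]

lemma exists_fox_minor_ne_zero {g : FreeMonoid X →* FreeMonoid (Fin 2)}
    (hg : ∃ x y, parikhMinor g x y ≠ 0) :
    ∃ x y, fox (fun c => (Pi.single c 1 : Fin 2 → ℕ)) 0 (g (of x)).toList *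
        fox (fun c => (Pi.single c 1 : Fin 2 → ℕ)) 1 (g (of y)).toList -
      fox (fun c => (Pi.single c 1 : Fin 2 → ℕ)) 0 (g (of y)).toList *
        fox (fun c => (Pi.single c 1 : Fin 2 → ℕ)) 1 (g (of x)).toList ≠ 0 := by
  obtain ⟨x, y, h⟩ := hg
  refine ⟨x, y, fun h0 => h ?_⟩
  have := congrArg (AddMonoidAlgebra.lift ℤ ℤ (Fin 2 → ℕ) 1) h0
  simpa only [map_sub, map_mul, sum_coeff_fox, map_zero, ← parikh_apply, parikhMinor] using this

lemma parikhHom_eq_iff [Fintype X] (g : FreeMonoid X →* FreeMonoid Y) (u v : X → ℕ) :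
    parikhHom g u = parikhHom g v ↔ ∀ c, ∑ x, ((u x : ℤ) - v x) * parikh g x c = 0 := by
  rw [funext_iff]
  refine forall_congr' fun c => ?_
  rw [parikhHom_apply, parikhHom_apply, ← Nat.cast_inj (R := ℤ), ← sub_eq_zero]
  push_cast
  simp only [sub_mul, Finset.sum_sub_distrib]

variable [DecidableEq X] [AddCommMonoid M] [AddCommMonoid N]

/-- The difference of the Fox derivatives of the two sides of an equation. -/
noncomputable def foxDiff (w : X → M) (E : Equation X) (x : X) : AddMonoidAlgebra ℤ M :=
  fox w x E.lhs.toList - fox w x E.rhs.toList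

lemma parikhHom_single [Fintype X] (g : FreeMonoid X →* FreeMonoid Y) (x : X) :
    parikhHom g (Pi.single x 1) = parikh g x := by
  change ∑ y, (Pi.single x 1 : X → ℕ) y • parikh g y = _
  rw [Finset.sum_eq_single x]
  · simp
  · intro y _ hy
    simp [hy]
  · simp

lemma mapDomainRingHom_foxDiff [Fintype X] (g : FreeMonoid X →* FreeMonoid Y) (E : Equation X)
    (x : X) : mapDomainRingHom ℤ (parikhHom g) (foxDiff (fun y => Pi.single y 1) E x) =
      foxDiff (parikh g) E x := by
  simp only [foxDiff, map_sub, mapDomainRingHom_fox, parikhHom_single]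

/-- A morphism solves an equation if and only if the Fox derivatives of its images are
orthogonal to the vector attached to the equation. -/
lemma map_lhs_eq_map_rhs_iff [Fintype X] (g : FreeMonoid X →* FreeMonoid Y) (E : Equation X) :
    g E.lhs = g E.rhs ↔ ∀ c, ∑ x, foxDiff (parikh g) E x *
      fox (fun c => (Pi.single c 1 : Y → ℕ)) c (g (of x)).toList = 0 := by
  have h : ∀ c, ∑ x, foxDiff (parikh g) E x *
      fox (fun c => (Pi.single c 1 : Y → ℕ)) c (g (of x)).toList =
      fox (fun c => (Pi.single c 1 : Y → ℕ)) c (g E.lhs).toList -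
        fox (fun c => (Pi.single c 1 : Y → ℕ)) c (g E.rhs).toList := by
    intro c
    have h1 := fox_hom (fun c => (Pi.single c 1 : Y → ℕ)) c g E.lhs.toList
    have h2 := fox_hom (fun c => (Pi.single c 1 : Y → ℕ)) c g E.rhs.toList
    rw [ofList_toList] at h1 h2
    rw [h1, h2, ← Finset.sum_sub_distrib]
    exact Finset.sum_congr rfl fun x _ => sub_mul _ _ _
  constructor
  · intro he c
    rw [h, he, sub_self]
  · intro he
    refine toList.injective (eq_of_fox_eq (fun c => (Pi.single c 1 : Y → ℕ)) ?_ fun c => ?_)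
    · intro a b ha
      simp at ha
    · rw [← sub_eq_zero, ← h, he]

/-- Two zero columns would leave rank at most one. This supplies the weight hypothesis of
`eq_of_fox_eq`. -/
lemma eq_of_parikh_eq_zero {g : FreeMonoid (Fin 3) →* FreeMonoid (Fin 2)}
    (hg : ∃ x y, parikhMinor g x y ≠ 0) (a b : Fin 3) (ha : parikh g a = 0)
    (hb : parikh g b = 0) : a = b := by
  by_contra hab
  obtain ⟨x, y, h⟩ := hg
  apply h
  have : x = y ∨ x = a ∨ x = b ∨ y = a ∨ y = b := by omega
  rcases this with rfl | rfl | rfl | rfl | rfl <;> simp [parikhMinor, *]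

lemma exists_foxDiff_ne_zero {g : FreeMonoid (Fin 3) →* FreeMonoid (Fin 2)}
    (hg : ∃ x y, parikhMinor g x y ≠ 0) {E : Equation (Fin 3)} (hE : ¬ E.IsTrivial) :
    ∃ x, foxDiff (parikh g) E x ≠ 0 := by
  by_contra! h
  exact hE (toList.injective (eq_of_fox_eq (parikh g) (eq_of_parikh_eq_zero hg)
    fun x => sub_eq_zero.1 (h x)))

/-- The minors of the pair of vectors attached to two equations. -/
noncomputable def eqMinor (E F : Equation X) (x y : X) : AddMonoidAlgebra ℤ (X → ℕ) :=
  foxDiff (fun z => Pi.single z 1) E x * foxDiff (fun z => Pi.single z 1) F y -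
    foxDiff (fun z => Pi.single z 1) E y * foxDiff (fun z => Pi.single z 1) F x

lemma mapDomainRingHom_eqMinor [Fintype X] (g : FreeMonoid X →* FreeMonoid Y) (E F : Equation X)
    (x y : X) : mapDomainRingHom ℤ (parikhHom g) (eqMinor E F x y) =
      foxDiff (parikh g) E x * foxDiff (parikh g) F y -
        foxDiff (parikh g) E y * foxDiff (parikh g) F x := by
  simp only [eqMinor, map_sub, map_mul, mapDomainRingHom_foxDiff]

/-- Both pushed-forward vectors are orthogonal to the two independent vectors of Fox derivatives,
hence parallel. -/
lemma mapDomainRingHom_eqMinor_eq_zero {g : FreeMonoid (Fin 3) →* FreeMonoid (Fin 2)}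
    (hg : ∃ x y, parikhMinor g x y ≠ 0) {E F : Equation (Fin 3)} (hE : g E.lhs = g E.rhs)
    (hF : g F.lhs = g F.rhs) (x y : Fin 3) :
    mapDomainRingHom ℤ (parikhHom g) (eqMinor E F x y) = 0 := by
  rw [map_lhs_eq_map_rhs_iff] at hE hF
  rw [mapDomainRingHom_eqMinor, sub_eq_zero]
  exact mul_eq_mul_of_orthogonal (exists_fox_minor_ne_zero hg) (hE 0) (hE 1) (hF 0) (hF 1) x y

/-- Vanishing minors make the vector of `F` parallel to the nonzero vector of `E`, so it inherits
the orthogonality relations. -/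
lemma map_eq_of_mapDomainRingHom_eqMinor_eq_zero {g : FreeMonoid (Fin 3) →* FreeMonoid (Fin 2)}
    (hg : ∃ x y, parikhMinor g x y ≠ 0) {E F : Equation (Fin 3)} (hE : g E.lhs = g E.rhs)
    (hnt : ¬ E.IsTrivial)
    (h : ∀ x y, mapDomainRingHom ℤ (parikhHom g) (eqMinor E F x y) = 0) :
    g F.lhs = g F.rhs := by
  rw [map_lhs_eq_map_rhs_iff] at hE ⊢
  obtain ⟨k, hk⟩ := exists_foxDiff_ne_zero hg hnt
  intro c
  refine sum_mul_eq_zero_of_parallel hk (fun i j => ?_) (hE c)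
  rw [← sub_eq_zero, ← mapDomainRingHom_eqMinor]
  exact h i j

/-- Two morphisms of rank two whose Parikh matrices have a common kernel vector have the same
kernel. -/
lemma parikhHom_eq_of_common_kernel {g g' : FreeMonoid (Fin 3) →* FreeMonoid (Fin 2)}
    (hg : ∃ x y, parikhMinor g x y ≠ 0) {d : Fin 3 → ℤ} (hd : d ≠ 0)
    (h : ∀ c, ∑ x, d x * parikh g x c = 0) (h' : ∀ c, ∑ x, d x * parikh g' x c = 0)
    {e : Fin 3 → ℤ} (he : ∀ c, ∑ x, e x * parikh g x c = 0) (c : Fin 2) :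
    ∑ x, e x * parikh g' x c = 0 := by
  obtain ⟨k, hk⟩ := Function.ne_iff.1 hd
  exact sum_mul_eq_zero_of_parallel hk
    (mul_eq_mul_of_orthogonal (p := fun x => (parikh g x 0 : ℤ)) (p' := fun x => (parikh g x 1 : ℤ))
      hg (h 0) (h 1) (he 0) (he 1)) (h' c)

/-- Solutions of a nontrivial equation whose Parikh matrices have the same kernel solve the
same equations. -/
lemma map_eq_of_common_kernel {g g' : FreeMonoid (Fin 3) →* FreeMonoid (Fin 2)}
    (hg : ∃ x y, parikhMinor g x y ≠ 0) (hg' : ∃ x y, parikhMinor g' x y ≠ 0)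
    {d : Fin 3 → ℤ} (hd : d ≠ 0)
    (h : ∀ c, ∑ x, d x * parikh g x c = 0) (h' : ∀ c, ∑ x, d x * parikh g' x c = 0)
    {E F : Equation (Fin 3)} (hnt : ¬ E.IsTrivial) (hE : g E.lhs = g E.rhs)
    (hE' : g' E.lhs = g' E.rhs) (hF : g F.lhs = g F.rhs) : g' F.lhs = g' F.rhs := by
  refine map_eq_of_mapDomainRingHom_eqMinor_eq_zero hg' hE' hnt fun x y => ?_
  have h0 := mapDomainRingHom_eqMinor_eq_zero hg hE hF x y
  -- Exponents identified by `g` are identified by `g'`, so the push-forward along `g'` factors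
  -- through the one along `g`, which kills the minor.
  have hfac : Function.FactorsThrough (parikhHom g') (parikhHom g) := by
    intro u v huv
    rw [parikhHom_eq_iff] at huv ⊢
    exact parikhHom_eq_of_common_kernel hg hd h h' huv
  rw [mapDomainRingHom_apply] at h0 ⊢
  have hk : ⇑(parikhHom g') =
      Function.extend (parikhHom g) (parikhHom g') 0 ∘ (parikhHom g) :=
    funext fun u => (hfac.extend_apply 0 u).symm
  rw [mapDomain, hk, Finsupp.mapDomain_comp]
  have h1 : Finsupp.mapDomain (parikhHom g) (eqMinor E F x y).coeff = 0 := by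
    simpa [mapDomain] using h0
  rw [h1]
  simp

end Solutions

/-! ### Cancellation of least monomials -/

section Cover

open AddMonoidAlgebra

variable {M N L : Type*}

/-- The sum of the monomials with exponents in a list. -/
noncomputable def monomialSum (l : List M) : AddMonoidAlgebra ℤ M :=
  (l.map fun m => single m 1).sum

/-- The difference of the positive and negative parts given by a list of pairs. -/
noncomputable def signedSum (T : List (List M × List M)) : AddMonoidAlgebra ℤ M :=
  (T.map fun t => monomialSum t.1 - monomialSum t.2).sum

lemma signedSum_append (S T : List (List M × List M)) :
    signedSum (S ++ T) = signedSum S + signedSum T := by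
  simp [signedSum]

lemma coeff_monomialSum [DecidableEq M] (l : List M) (m : M) :
    (monomialSum l).coeff m = l.count m := by
  induction l with
  | nil => simp [monomialSum]
  | cons a l ih =>
    have : monomialSum (a :: l) = single a 1 + monomialSum l := by simp [monomialSum]
    rw [this, coeff_add, Finsupp.add_apply, ih, coeff_single, Finsupp.single_apply,
      List.count_cons]
    simp only [beq_iff_eq, Nat.cast_add, Nat.cast_ite, Nat.cast_one, Nat.cast_zero]
    ring

lemma exists_mem_fst_of_coeff_pos {T : List (List M × List M)} {m : M}
    (h : 0 < (signedSum T).coeff m) : ∃ t ∈ T, m ∈ t.1 := by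
  classical
  induction T with
  | nil => simp [signedSum] at h
  | cons t T ih =>
    have : signedSum (t :: T) = (monomialSum t.1 - monomialSum t.2) + signedSum T := by
      simp [signedSum]
    rw [this, coeff_add, coeff_sub, Finsupp.add_apply, Finsupp.sub_apply, coeff_monomialSum,
      coeff_monomialSum] at h
    by_cases hm : m ∈ t.1
    · exact ⟨t, by simp, hm⟩
    · rw [List.count_eq_zero_of_not_mem hm] at h
      obtain ⟨t', ht', hm'⟩ := ih (by push_cast at h; omega)
      exact ⟨t', by simp [ht'], hm'⟩

lemma exists_mem_snd_of_coeff_neg {T : List (List M × List M)} {m : M}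
    (h : (signedSum T).coeff m < 0) : ∃ t ∈ T, m ∈ t.2 := by
  have hswap : signedSum (T.map Prod.swap) = -signedSum T := by
    clear h
    induction T with
    | nil => simp [signedSum]
    | cons t T ih =>
      simp only [signedSum, List.map_map, List.map_cons, List.sum_cons] at ih ⊢
      rw [ih]
      simp [add_comm]
  have h1 : 0 < (signedSum (T.map Prod.swap)).coeff m := by
    rw [hswap]
    simpa using h
  obtain ⟨t, ht, hm⟩ := exists_mem_fst_of_coeff_pos h1
  obtain ⟨s, hs, rfl⟩ := List.mem_map.1 ht
  exact ⟨s, hs, hm⟩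

/-- The first element of the chain satisfying `p` works; if there is none, the claim is vacuous and
any value will do. -/
lemma exists_le_of_pairwise [Preorder M] [Inhabited M] {l : List M} (hl : l.Pairwise (· ≤ ·))
    (p : M → Prop) : ∃ m, ∀ a ∈ l, p a → p m ∧ m ≤ a := by
  induction l with
  | nil => exact ⟨default, by simp⟩
  | cons b l ih =>
    rw [List.pairwise_cons] at hl
    by_cases hb : p b
    · refine ⟨b, fun a ha _ => ⟨hb, ?_⟩⟩
      rcases List.mem_cons.1 ha with rfl | ha
      · exact le_rfl
      · exact hl.1 a ha
    · obtain ⟨m, hm⟩ := ih hl.2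
      refine ⟨m, fun a ha hpa => ?_⟩
      rcases List.mem_cons.1 ha with rfl | ha
      · exact absurd hpa hb
      · exact hm a ha hpa

/-- In the fibre over a least image of the support the coefficients sum to zero but are not all
zero, so both signs occur there. -/
lemma exists_pos_neg_of_mapDomain_eq_zero [LinearOrder L] {τ : N → L}
    {f : AddMonoidAlgebra ℤ M} (hf : f ≠ 0) {G : M → N} (hG : mapDomain G f = 0) :
    ∃ a b, 0 < f.coeff a ∧ f.coeff b < 0 ∧ G a = G b ∧
      ∀ m ∈ f.coeff.support, τ (G a) ≤ τ (G m) := by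
  classical
  have hs : f.coeff.support.Nonempty := by
    rw [Finsupp.support_nonempty_iff]
    simpa using hf
  obtain ⟨m, hm, hmin⟩ := f.coeff.support.exists_min_image (fun m => τ (G m)) hs
  have h0 : ∑ a ∈ f.coeff.support with G a = G m, f.coeff a = 0 := by
    have h1 : (mapDomain G f).coeff (G m) = 0 := by rw [hG]; simp
    rw [mapDomain] at h1
    simp only [Finsupp.mapDomain, Finsupp.sum_apply] at h1
    rw [Finset.sum_filter]
    refine Eq.trans (Finset.sum_congr rfl fun a _ => ?_) h1
    exact Finsupp.single_apply.symm
  have hmem : m ∈ f.coeff.support.filter (fun a => G a = G m) := Finset.mem_filter.2 ⟨hm, rfl⟩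
  have hne : f.coeff m ≠ 0 := Finsupp.mem_support_iff.1 hm
  obtain ⟨a, ha, hpos⟩ := Finset.exists_pos_of_sum_zero_of_exists_nonzero _ h0 ⟨m, hmem, hne⟩
  obtain ⟨b, hb, hneg⟩ := Finset.exists_pos_of_sum_zero_of_exists_nonzero (fun a => -f.coeff a)
    (by rw [Finset.sum_neg_distrib, h0, neg_zero]) ⟨m, hmem, neg_ne_zero.2 hne⟩
  rw [Finset.mem_filter] at ha hb
  refine ⟨a, b, hpos, by omega, ha.2.trans hb.2.symm, fun c hc => ?_⟩
  rw [ha.2]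
  exact hmin c hc

/-- If an element of a monoid algebra is a signed sum of `n` pairs of chains of monomials, then
there are `n` positive and `n` negative monomials such that every monotone map annihilating the
element identifies one of the former with one of the latter. -/
lemma exists_monomials_of_signedSum [PartialOrder M] [Inhabited M] [PartialOrder N] [LinearOrder L]
    {τ : N → L} (hτ : Function.Injective τ) (hτm : Monotone τ) {T : List (List M × List M)}
    (hT : ∀ t ∈ T, t.1.Pairwise (· ≤ ·) ∧ t.2.Pairwise (· ≤ ·)) (hf : signedSum T ≠ 0) :
    ∃ p q : Fin T.length → M, ∀ G : M → N, Monotone G → mapDomain G (signedSum T) = 0 →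
      ∃ i j, p i ≠ q j ∧ G (p i) = G (q j) := by
  choose p hp using fun i : Fin T.length => exists_le_of_pairwise (hT _ (T.get_mem i)).1
    fun m => 0 < (signedSum T).coeff m
  choose q hq using fun i : Fin T.length => exists_le_of_pairwise (hT _ (T.get_mem i)).2
    fun m => (signedSum T).coeff m < 0
  refine ⟨p, q, fun G hGm hG => ?_⟩
  obtain ⟨a, b, ha, hb, hab, hmin⟩ := exists_pos_neg_of_mapDomain_eq_zero (τ := τ) hf hG
  obtain ⟨s, hs, has⟩ := exists_mem_fst_of_coeff_pos ha
  obtain ⟨t, ht, hbt⟩ := exists_mem_snd_of_coeff_neg hb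
  obtain ⟨i, rfl⟩ := List.get_of_mem hs
  obtain ⟨j, rfl⟩ := List.get_of_mem ht
  obtain ⟨hpi, hle⟩ := hp i a has ha
  obtain ⟨hqj, hle'⟩ := hq j b hbt hb
  -- Monotonicity gives one inequality; `p i` lies in the support, so minimality of `G a` gives the
  -- other.
  have e1 : G (p i) = G a := hτ (le_antisymm (hτm (hGm hle))
    (hmin _ (Finsupp.mem_support_iff.2 hpi.ne')))
  have e2 : G (q j) = G b := hτ (le_antisymm (hτm (hGm hle'))
    (hab ▸ hmin _ (Finsupp.mem_support_iff.2 hqj.ne)))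
  refine ⟨i, j, fun h => ?_, by rw [e1, e2, hab]⟩
  rw [h] at hpi
  omega

end Cover

/-! ### Chains of prefix weights and the covering by kernel vectors -/

section Positions

open AddMonoidAlgebra FreeMonoid

variable {X M : Type*} [DecidableEq X] [AddCommMonoid M]

/-- The weights of the prefixes before the occurrences of the letter `x`. -/
def positions (w : X → M) (x : X) : List X → List M
  | [] => []
  | a :: u => (if a = x then [0] else []) ++ (positions w x u).map (w a + ·)

/-- All translates of a pair of lists by the elements of a list. -/
def translates (A P Q : List M) : List (List M × List M) :=
  A.map fun a => (P.map (a + ·), Q.map (a + ·))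

lemma single_mul_monomialSum (a : M) (l : List M) :
    single a 1 * monomialSum l = monomialSum (l.map (a + ·)) := by
  induction l with
  | nil => simp [monomialSum]
  | cons b l ih =>
    simp only [monomialSum, List.map_cons, List.sum_cons, mul_add] at ih ⊢
    rw [ih]
    simp

lemma signedSum_translates (A P Q : List M) :
    signedSum (translates A P Q) = monomialSum A * (monomialSum P - monomialSum Q) := by
  induction A with
  | nil => simp [signedSum, translates, monomialSum]
  | cons a A ih =>
    have h1 : signedSum (translates (a :: A) P Q) = (monomialSum (P.map (a + ·)) -
        monomialSum (Q.map (a + ·))) + signedSum (translates A P Q) := by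
      simp [signedSum, translates]
    have h2 : monomialSum (a :: A) = single a 1 + monomialSum A := by simp [monomialSum]
    rw [h1, h2, ih, ← single_mul_monomialSum, ← single_mul_monomialSum]
    ring

lemma fox_eq_monomialSum (w : X → M) (x : X) (u : List X) :
    fox w x u = monomialSum (positions w x u) := by
  induction u with
  | nil => simp [positions, monomialSum]
  | cons a u ih =>
    rw [fox_cons, ih, single_mul_monomialSum, positions]
    by_cases h : a = x <;> simp [h, monomialSum, one_def]

lemma length_positions (w : X → M) (x : X) (u : List X) :
    (positions w x u).length = u.count x := by
  induction u with
  | nil => simp [positions]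
  | cons a u ih =>
    rw [positions, List.length_append, List.length_map, ih, List.count_cons]
    by_cases h : a = x <;> simp [h, add_comm]

lemma pairwise_positions [PartialOrder M] [CanonicallyOrderedAdd M] [AddLeftMono M] (w : X → M)
    (x : X) (u : List X) : (positions w x u).Pairwise (· ≤ ·) := by
  induction u with
  | nil => simp [positions]
  | cons a u ih =>
    have h : ((positions w x u).map (w a + ·)).Pairwise (· ≤ ·) :=
      ih.map _ fun _ _ h => by gcongr
    rw [positions]
    split_ifs
    · simp [h]
    · simpa using h

lemma pairwise_of_mem_translates [PartialOrder M] [AddLeftMono M] {A P Q : List M}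
    (hP : P.Pairwise (· ≤ ·)) (hQ : Q.Pairwise (· ≤ ·)) :
    ∀ t ∈ translates A P Q, t.1.Pairwise (· ≤ ·) ∧ t.2.Pairwise (· ≤ ·) := by
  intro t ht
  obtain ⟨a, _, rfl⟩ := List.mem_map.1 ht
  exact ⟨hP.map _ fun _ _ h => by gcongr, hQ.map _ fun _ _ h => by gcongr⟩

/-- The Parikh matrices annihilating a nonzero minor of a pair of equations have one of boundedly
many vectors in their kernels, where the bound depends on the first equation only. -/
lemma exists_cover [Fintype X] {E F : Equation X} {x y : X} (h : eqMinor E F x y ≠ 0) :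
    ∃ p q : Fin (E.occ x + E.occ y) → X → ℕ, ∀ g : FreeMonoid X →* FreeMonoid (Fin 2),
      mapDomainRingHom ℤ (parikhHom g) (eqMinor E F x y) = 0 →
      ∃ i j, p i ≠ q j ∧ parikhHom g (p i) = parikhHom g (q j) := by
  let pos : X → FreeMonoid X → List (X → ℕ) := fun x u =>
    positions (fun z => Pi.single z 1) x u.toList
  have hpos : ∀ x u, (pos x u).Pairwise (· ≤ ·) := fun x u => pairwise_positions _ _ _
  -- Only the factors coming from `E` are expanded into monomials, so the number of pairs does not
  -- involve `F`. Signs are absorbed by swapping the two lists of `F`.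
  let T := translates (pos x E.lhs) (pos y F.lhs) (pos y F.rhs) ++
    (translates (pos x E.rhs) (pos y F.rhs) (pos y F.lhs) ++
    (translates (pos y E.lhs) (pos x F.rhs) (pos x F.lhs) ++
      translates (pos y E.rhs) (pos x F.lhs) (pos x F.rhs)))
  have hT : signedSum T = eqMinor E F x y := by
    simp only [T, signedSum_append, signedSum_translates, eqMinor, foxDiff, fox_eq_monomialSum, pos]
    ring
  have hlen : T.length = E.occ x + E.occ y := by
    simp only [T, translates, List.length_append, List.length_map, length_positions, pos,
      Equation.occ, toList_mul, List.count_append]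
    ring
  have hpair : ∀ t ∈ T, t.1.Pairwise (· ≤ ·) ∧ t.2.Pairwise (· ≤ ·) := by
    intro t ht
    simp only [T, List.mem_append] at ht
    rcases ht with ht | ht | ht | ht <;>
      exact pairwise_of_mem_translates (hpos _ _) (hpos _ _) t ht
  rw [← hT] at h ⊢
  rw [← hlen]
  obtain ⟨p, q, hpq⟩ := exists_monomials_of_signedSum (N := Fin 2 → ℕ) (τ := toLex)
    toLex.injective Pi.toLex_monotone hpair h
  refine ⟨p, q, fun g hg => hpq (parikhHom g) (fun a b hab => ?_) hg⟩
  obtain ⟨c, rfl⟩ := exists_add_of_le hab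
  rw [map_add]
  exact le_self_add

end Positions

/-! ### Counting distinguishable nonperiodic solutions -/

section Classes

open FreeMonoid AddMonoidAlgebra

variable {A : Type*}

lemma exists_parikhMinor_of_mem_sol {h : FreeMonoid (Fin 3) →* FreeMonoid A} (hp : ¬ IsPeriodic h)
    {E : Equation (Fin 3)} (hnt : ¬ E.IsTrivial) (hE : h ∈ E.sol A) :
    ∃ g : FreeMonoid (Fin 3) →* FreeMonoid (Fin 2),
      (∀ F : Equation (Fin 3), h ∈ F.sol A ↔ g F.lhs = g F.rhs) ∧ ∃ y z, parikhMinor g y z ≠ 0 := by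
  obtain ⟨g, hg, hm⟩ := exists_parikhMinor_ne_zero hp hnt hE
  exact ⟨g, fun F => hg F.lhs F.rhs, hm⟩

lemma exists_eqMinor_ne_zero {h : FreeMonoid (Fin 3) →* FreeMonoid A} (hp : ¬ IsPeriodic h)
    {E F : Equation (Fin 3)} (hnt : ¬ E.IsTrivial) (hE : h ∈ E.sol A) (hF : h ∉ F.sol A) :
    ∃ x y, x ≠ y ∧ eqMinor E F x y ≠ 0 := by
  obtain ⟨g, hg, hm⟩ := exists_parikhMinor_of_mem_sol hp hnt hE
  by_contra! hcon
  refine hF ((hg F).2 (map_eq_of_mapDomainRingHom_eqMinor_eq_zero hm ((hg E).1 hE) hnt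
    fun x y => ?_))
  by_cases hxy : x = y
  · rw [mapDomainRingHom_eqMinor, hxy, sub_self]
  · rw [hcon x y hxy, map_zero]

/-- The number of common nonperiodic solutions of two equations that are pairwise distinguished by
further equations is bounded in terms of the first equation. -/
lemma card_le_of_distinguished {ι : Type*} [Fintype ι] {E F : Equation (Fin 3)} {x y : Fin 3}
    (hnt : ¬ E.IsTrivial) (hEF : eqMinor E F x y ≠ 0)
    (h : ι → FreeMonoid (Fin 3) →* FreeMonoid A) (hp : ∀ i, ¬ IsPeriodic (h i))
    (hE : ∀ i, h i ∈ E.sol A) (hF : ∀ i, h i ∈ F.sol A)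
    (hd : ∀ i j, i ≠ j → ∃ K : Equation (Fin 3), ¬ (h i ∈ K.sol A ↔ h j ∈ K.sol A)) :
    Fintype.card ι ≤ (E.occ x + E.occ y) ^ 2 := by
  obtain ⟨p, q, hpq⟩ := exists_cover hEF
  choose g hg hm using fun i => exists_parikhMinor_of_mem_sol (hp i) hnt (hE i)
  choose a b hab hk using fun i => hpq (g i) (mapDomainRingHom_eqMinor_eq_zero (hm i)
    ((hg i E).1 (hE i)) ((hg i F).1 (hF i)) x y)
  -- Equal index pairs give a common nonzero kernel vector `p (a i) - q (b i)`, and then the two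
  -- solutions solve the same equations.
  have hinj : Function.Injective fun i => (a i, b i) := by
    intro i j hij
    simp only [Prod.mk.injEq] at hij
    by_contra hne
    obtain ⟨K, hK⟩ := hd i j hne
    have h1 : ∀ i' j', a i' = a j' → b i' = b j' → h i' ∈ K.sol A → h j' ∈ K.sol A := by
      intro i' j' ha hb hi
      have hj := hk j'
      rw [← ha, ← hb, parikhHom_eq_iff] at hj
      refine (hg j' K).2 (map_eq_of_common_kernel (hm i') (hm j') (fun hzero => hab i' ?_)
        ((parikhHom_eq_iff _ _ _).1 (hk i')) hj hnt ((hg i' E).1 (hE i')) ((hg j' E).1 (hE j'))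
        ((hg i' K).1 hi))
      funext z
      have := congrFun hzero z
      simp only [Pi.zero_apply] at this
      omega
    exact hK ⟨h1 i j hij.1 hij.2, h1 j i hij.1.symm hij.2.symm⟩
  have := Fintype.card_le_of_injective _ hinj
  rwa [Fintype.card_prod, Fintype.card_fin, ← sq] at this

end Classes

/-! ### Periodic solutions and linear equations -/

section Periodic

open FreeMonoid

variable {X A : Type*}

/-- A strictly decreasing sequence of solution sets of linear equations is short. -/
lemma card_le_of_triangular {ι : Type*} [Fintype ι] [LinearOrder ι] [Fintype X]
    (d a : ι → X → ℤ) (h0 : ∀ i j, j < i → ∑ x, d j x * a i x = 0)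
    (h1 : ∀ i, ∑ x, d i x * a i x ≠ 0) : Fintype.card ι ≤ Fintype.card X := by
  have hli : LinearIndependent ℤ d := by
    rw [Fintype.linearIndependent_iff]
    intro c hc i
    -- Descending induction: pairing the relation with `a i` kills the terms `j < i` by `h0`, and
    -- those with `j > i` have zero coefficient already.
    induction i using WellFoundedGT.induction with
    | _ i ih =>
    have h2 : ∑ j, c j * ∑ x, d j x * a i x = 0 := by
      have : ∀ x, ∑ j, c j * d j x = 0 := fun x => by
        simpa using congrFun hc x
      simp only [Finset.mul_sum]
      rw [Finset.sum_comm]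
      refine Finset.sum_eq_zero fun x _ => ?_
      rw [← zero_mul (a i x), ← this x, Finset.sum_mul]
      exact Finset.sum_congr rfl fun j _ => by ring
    rw [Finset.sum_eq_single i] at h2
    · exact (mul_eq_zero.1 h2).resolve_right (h1 i)
    · intro j _ hj
      rcases lt_or_gt_of_ne hj with hlt | hgt
      · rw [h0 i j hlt, mul_zero]
      · rw [ih j hgt, zero_mul]
    · simp
  simpa using hli.fintype_card_le_finrank

variable [DecidableEq X]

/-- The difference of the Parikh vectors of the two sides of an equation. -/
def balance (E : Equation X) (x : X) : ℤ :=
  (E.lhs.toList.count x : ℤ) - E.rhs.toList.count x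

lemma map_eq_pow [Fintype X] {h : FreeMonoid X →* FreeMonoid A} {t : FreeMonoid A} {a : X → ℕ}
    (ha : ∀ x, t ^ a x = h (of x)) (u : FreeMonoid X) :
    h u = t ^ ∑ x, u.toList.count x * a x := by
  induction u using FreeMonoid.inductionOn' with
  | one => simp
  | of_mul x u ih =>
    rw [map_mul, ih, ← ha, ← pow_add]
    congr 1
    have : ∀ y, (of x * u).toList.count y * a y = (if x = y then a y else 0) +
        u.toList.count y * a y := by
      intro y
      rw [toList_of_mul, List.count_cons]
      by_cases hxy : x = y
      · simp [hxy]
        ring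
      · simp [hxy]
    simp only [this, Finset.sum_add_distrib, Finset.sum_ite_eq, Finset.mem_univ, if_true]

lemma length_pow (t : FreeMonoid A) (n : ℕ) : (t ^ n).length = n * t.length := by
  induction n with
  | zero => simp
  | succ n ih => rw [pow_succ, length_mul, ih]; ring

/-- A periodic morphism solves an equation if and only if its exponents satisfy the corresponding
linear equation. -/
lemma exists_mem_sol_iff_of_isPeriodic [Fintype X] {h : FreeMonoid X →* FreeMonoid A}
    (hp : IsPeriodic h) :
    ∃ a : X → ℤ, ∀ E : Equation X, h ∈ E.sol A ↔ ∑ x, balance E x * a x = 0 := by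
  obtain ⟨t, ht⟩ := (isPeriodic_iff h).1 hp
  choose a ha using ht
  by_cases h1 : t = 1
  -- For the empty root every equation holds whatever the chosen exponents, so they are reset to
  -- zero.
  · refine ⟨0, fun E => ?_⟩
    have : h E.lhs = h E.rhs := by rw [map_eq_pow ha, map_eq_pow ha, h1, one_pow, one_pow]
    simpa [Equation.sol] using this
  · refine ⟨fun x => a x, fun E => ?_⟩
    have hE : ∑ x, balance E x * a x = ((∑ x, E.lhs.toList.count x * a x : ℕ) : ℤ) -
        (∑ x, E.rhs.toList.count x * a x : ℕ) := by
      push_cast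
      simp only [balance, sub_mul, Finset.sum_sub_distrib]
    rw [hE, sub_eq_zero, Nat.cast_inj]
    change h E.lhs = h E.rhs ↔ _
    rw [map_eq_pow ha, map_eq_pow ha]
    refine ⟨fun he => ?_, fun he => by rw [he]⟩
    have := congrArg length he
    rw [length_pow, length_pow] at this
    exact Nat.eq_of_mul_eq_mul_right (Nat.pos_of_ne_zero (by simpa using h1)) this

/-- Counting the letter `c` on both sides places the balance vector in the kernel of the Parikh
matrix of every solution. -/
lemma sum_balance_mul_parikh [Fintype X] {Y : Type*} [DecidableEq Y]
    {g : FreeMonoid X →* FreeMonoid Y} {E : Equation X} (h : g E.lhs = g E.rhs) (c : Y) :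
    ∑ x, balance E x * parikh g x c = 0 := by
  have key : ∀ u : FreeMonoid X,
      (g u).toList.count c = ∑ x, u.toList.count x * parikh g x c := by
    intro u
    induction u using FreeMonoid.inductionOn' with
    | one => simp
    | of_mul x u ih =>
      rw [map_mul, toList_mul, List.count_append, ih, ← parikh_apply]
      have : ∀ y, (of x * u).toList.count y * parikh g y c = (if x = y then parikh g y c else 0) +
          u.toList.count y * parikh g y c := by
        intro y
        rw [toList_of_mul, List.count_cons]
        by_cases hxy : x = y
        · simp [hxy]
          ring
        · simp [hxy]
      simp only [this, Finset.sum_add_distrib, Finset.sum_ite_eq, Finset.mem_univ, if_true]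
  simp only [balance, sub_mul, Finset.sum_sub_distrib]
  rw [sub_eq_zero]
  exact_mod_cast (key E.lhs).symm.trans ((congrArg (fun w => w.toList.count c) h).trans
    (key E.rhs))

end Periodic

/-! ### Independent systems -/

section Independent

variable {A ι : Type*} {E : ι → Equation (Fin 3)}

lemma IsIndependent.exists_mem_sol_iff {X : Type*} {E : ι → Equation X} (hE : IsIndependent A E)
    (k : ι) : ∃ h : FreeMonoid X →* FreeMonoid A, ∀ i, h ∈ (E i).sol A ↔ i ≠ k := by
  have h1 : sysSol A E Set.univ ⊆ sysSol A E {i | i ≠ k} := fun h hh i _ => hh i trivial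
  have h2 := hE {i | i ≠ k} (Set.ssubset_univ_iff.2 fun h => by
    have : k ∈ {i | i ≠ k} := h ▸ trivial
    exact this rfl)
  obtain ⟨h, hh, hn⟩ := Set.exists_of_ssubset (h1.ssubset_of_ne (Ne.symm h2))
  refine ⟨h, fun i => ⟨?_, fun hi => hh i hi⟩⟩
  rintro hi rfl
  refine hn fun j _ => ?_
  by_cases hj : j = i
  · exact hj ▸ hi
  · exact hh j hj

lemma not_isTrivial_of_not_mem_sol {X : Type*} {F : Equation X}
    {h : FreeMonoid X →* FreeMonoid A} (hF : h ∉ F.sol A) : ¬ F.IsTrivial :=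
  fun ht => hF (congrArg h ht)

/-- In an independent system of at least two equations with a nonperiodic solution, every unknown
occurs equally often on the two sides of each equation. -/
lemma IsIndependent.balance_eq_zero (hE : IsIndependent A E)
    {h : FreeMonoid (Fin 3) →* FreeMonoid A} (hp : ¬ IsPeriodic h)
    (hh : ∀ i, h ∈ (E i).sol A) {i j : ι} (hij : i ≠ j) : balance (E j) = 0 := by
  by_contra hne
  obtain ⟨k, hk⟩ := Function.ne_iff.1 hne
  obtain ⟨s, hs⟩ := hE.exists_mem_sol_iff j
  have hnt : ¬ (E j).IsTrivial := not_isTrivial_of_not_mem_sol fun h' => (hs j).1 h' rfl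
  obtain ⟨f, hf⟩ := hE.exists_mem_sol_iff i
  have hfj : f ∈ (E j).sol A := (hf j).2 (Ne.symm hij)
  have hfi : f ∉ (E i).sol A := fun h' => (hf i).1 h' rfl
  obtain ⟨g, hg, hm⟩ := exists_parikhMinor_of_mem_sol hp hnt (hh j)
  have hgj := (hg (E j)).1 (hh j)
  have hgi := (hg (E i)).1 (hh i)
  by_cases hpf : IsPeriodic f
  -- The rank-two solution `g` forces the balances of `E i` and `E j` to be parallel, so a periodic
  -- solution of `E j` solves `E i`.
  · obtain ⟨a, ha⟩ := exists_mem_sol_iff_of_isPeriodic hpf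
    refine hfi ((ha _).2 (sum_mul_eq_zero_of_parallel hk (mul_eq_mul_of_orthogonal hm
      (sum_balance_mul_parikh hgj 0) (sum_balance_mul_parikh hgj 1)
      (sum_balance_mul_parikh hgi 0) (sum_balance_mul_parikh hgi 1)) ((ha _).1 hfj)))
  -- The nonzero balance of `E j` is a kernel vector common to `g` and `g'`.
  · obtain ⟨g', hg', hm'⟩ := exists_parikhMinor_of_mem_sol hpf hnt hfj
    have hgj' := (hg' (E j)).1 hfj
    exact hfi ((hg' (E i)).2 (map_eq_of_common_kernel hm hm' hne (sum_balance_mul_parikh hgj)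
      (sum_balance_mul_parikh hgj') hnt hgj hgj' hgi))

theorem IsIndependent.card_le [Fintype ι] (hE : IsIndependent A E)
    {h : FreeMonoid (Fin 3) →* FreeMonoid A} (hp : ¬ IsPeriodic h)
    (hh : ∀ i, h ∈ (E i).sol A) (i₀ : ι) :
    ∃ x y : Fin 3, x ≠ y ∧ Fintype.card ι ≤ ((E i₀).occ x + (E i₀).occ y) ^ 2 + 1 := by
  classical
  by_cases hι : ∃ k₀, k₀ ≠ i₀
  · obtain ⟨k₀, hk₀⟩ := hι
    choose w hw using hE.exists_mem_sol_iff
    -- All balances vanish, so a periodic morphism would solve every equation, including `E k`.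
    have hwp : ∀ k, ¬ IsPeriodic (w k) := by
      intro k hk
      obtain ⟨a, ha⟩ := exists_mem_sol_iff_of_isPeriodic hk
      obtain ⟨l, hl⟩ : ∃ l, l ≠ k := by
        by_cases hki : k = i₀
        · exact ⟨k₀, hki ▸ hk₀⟩
        · exact ⟨i₀, Ne.symm hki⟩
      exact (hw k k).1 ((ha _).2 (by simp [hE.balance_eq_zero hp hh hl])) rfl
    have hnt : ¬ (E i₀).IsTrivial :=
      not_isTrivial_of_not_mem_sol fun h' => (hw i₀ i₀).1 h' rfl
    obtain ⟨x, y, hxy, hm⟩ := exists_eqMinor_ne_zero (F := E k₀) (hwp k₀) hnt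
      ((hw k₀ i₀).2 (Ne.symm hk₀)) fun h' => (hw k₀ k₀).1 h' rfl
    refine ⟨x, y, hxy, ?_⟩
    -- The value `none` stands for the common solution `h`. With the witnesses other than those of
    -- `i₀` and `k₀` this gives m - 1 solutions.
    have hcard := card_le_of_distinguished (ι := Option {k // k ≠ i₀ ∧ k ≠ k₀}) hnt hm
      (fun o => o.elim h fun k => w k)
      (by rintro (_ | k); exacts [hp, hwp k])
      (by rintro (_ | k); exacts [hh i₀, (hw k i₀).2 (Ne.symm k.2.1)])
      (by rintro (_ | k); exacts [hh k₀, (hw k k₀).2 (Ne.symm k.2.2)])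
      (by
        rintro (_ | k) (_ | l) hkl
        · exact absurd rfl hkl
        · exact ⟨E l, by simp [hh, hw]⟩
        · exact ⟨E k, by simp [hh, hw]⟩
        · refine ⟨E k, ?_⟩
          have : k.1 ≠ l.1 := fun h' => hkl (by rw [Subtype.ext h'])
          simp [hw, this])
    have h2 : Fintype.card {k // k ≠ i₀ ∧ k ≠ k₀} = Fintype.card ι - 2 := by
      rw [Fintype.card_subtype]
      have : (Finset.univ.filter fun k => k ≠ i₀ ∧ k ≠ k₀) = ({i₀, k₀} : Finset ι)ᶜ := by
        ext k
        simp
      rw [this, Finset.card_compl, Finset.card_pair (Ne.symm hk₀)]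
    rw [Fintype.card_option, h2] at hcard
    omega
  · push Not at hι
    refine ⟨0, 1, by decide, ?_⟩
    have : Fintype.card ι ≤ 1 := Fintype.card_le_one_iff.2 fun a b => by rw [hι a, hι b]
    omega

end Independent

/-! ### Chains -/

section Chain

variable {A : Type*} {m : ℕ}

lemma IsChain.exists_mem_sol {X : Type*} {E : Fin m → Equation X} (hE : IsChain A E) (k : Fin m)
    (hk : 0 < k.1) : ∃ h : FreeMonoid X →* FreeMonoid A,
      (∀ j < k, h ∈ (E j).sol A) ∧ h ∉ (E k).sol A := by
  let l : Fin m := ⟨k.1 - 1, by omega⟩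
  have hlk : l < k := Fin.lt_def.2 (by simp only [l]; omega)
  obtain ⟨h, hh, hn⟩ := Set.exists_of_ssubset (hE.2 hlk)
  have hlt : ∀ j < k, h ∈ (E j).sol A := fun j hj => hh j (by
    rw [Set.mem_Iic, Fin.le_def]
    have := Fin.lt_def.1 hj
    simp only [l]
    omega)
  refine ⟨h, hlt, fun hk' => hn fun j hj => ?_⟩
  rcases lt_or_eq_of_le (Set.mem_Iic.1 hj) with hj | rfl
  · exact hlt j hj
  · exact hk'

theorem IsChain.length_le {E : Fin m → Equation (Fin 3)} (hE : IsChain A E) (hm : 0 < m) :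
    ∃ x y : Fin 3, x ≠ y ∧ m ≤ ((E ⟨0, hm⟩).occ x + (E ⟨0, hm⟩).occ y) ^ 2 + 5 := by
  classical
  have hex : ∀ k : Fin m, ∃ h : FreeMonoid (Fin 3) →* FreeMonoid A,
      0 < k.1 → (∀ j < k, h ∈ (E j).sol A) ∧ h ∉ (E k).sol A := by
    intro k
    by_cases hk : 0 < k.1
    · obtain ⟨h, hh⟩ := hE.exists_mem_sol k hk
      exact ⟨h, fun _ => hh⟩
    · exact ⟨1, fun h => absurd h hk⟩
  choose w hw using hex
  let B : Finset (Fin m) := {k | 0 < k.1 ∧ IsPeriodic (w k)}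
  let C : Finset (Fin m) := {k | 0 < k.1 ∧ ¬ IsPeriodic (w k)}
  have hBmem : ∀ k ∈ B, 0 < k.1 ∧ IsPeriodic (w k) := fun k hk => by simpa [B] using hk
  have hCmem : ∀ k ∈ C, 0 < k.1 ∧ ¬ IsPeriodic (w k) := fun k hk => by simpa [C] using hk
  have hm1 : m ≤ 1 + B.card + C.card := by
    have hcover : (Finset.univ : Finset (Fin m)) ⊆ ({⟨0, hm⟩} ∪ B) ∪ C := by
      intro k _
      by_cases hk : 0 < k.1
      · by_cases hp : IsPeriodic (w k) <;> simp [B, C, hk, hp]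
      · have : k = ⟨0, hm⟩ := Fin.ext (by simp only; omega)
        simp [this]
    have h1 := Finset.card_le_card hcover
    have h2 := Finset.card_union_le ({⟨0, hm⟩} ∪ B) C
    have h3 := Finset.card_union_le {⟨0, hm⟩} B
    rw [Finset.card_univ, Fintype.card_fin] at h1
    rw [Finset.card_singleton] at h3
    omega
  -- A periodic witness satisfies the earlier linear equations but not its own, a triangular pattern
  -- in dimension three.
  have hB : B.card ≤ 3 := by
    choose a ha using fun k : B => exists_mem_sol_iff_of_isPeriodic (hBmem k k.2).2
    have := card_le_of_triangular (fun k : B => balance (E k)) a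
      (fun i j hij => (ha i _).1 ((hw i (hBmem i i.2).1).1 j hij))
      (fun i hi => (hw i (hBmem i i.2).1).2 ((ha i _).2 hi))
    simpa using this
  by_cases hC : C.Nonempty
  -- With the least nonperiodic index as `k₀`, all other nonperiodic witnesses solve both the first
  -- equation and `E k₀`. The constant 5 counts index 0, three periodic indices and `k₀`.
  · let k₀ := C.min' hC
    have hk₀ : k₀ ∈ C := C.min'_mem hC
    have hlt : ∀ k ∈ C, (⟨0, hm⟩ : Fin m) < k := fun k hk => (hCmem k hk).1
    obtain ⟨x, y, hxy, hmin⟩ := exists_eqMinor_ne_zero (F := E k₀) (hCmem k₀ hk₀).2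
      (hE.1 ⟨0, hm⟩) ((hw k₀ (hCmem k₀ hk₀).1).1 _ (hlt k₀ hk₀)) (hw k₀ (hCmem k₀ hk₀).1).2
    refine ⟨x, y, hxy, ?_⟩
    have hmem : ∀ k : C.erase k₀, k.1 ∈ C := fun k => Finset.mem_of_mem_erase k.2
    have hdist : ∀ k l : C.erase k₀, k < l →
        w l ∈ (E k).sol A ∧ w k ∉ (E k).sol A := fun k l hkl =>
      ⟨(hw l (hCmem l (hmem l)).1).1 k hkl, (hw k (hCmem k (hmem k)).1).2⟩
    have hcard := card_le_of_distinguished (ι := C.erase k₀) (hE.1 ⟨0, hm⟩) hmin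
      (fun k => w k) (fun k => (hCmem k (hmem k)).2)
      (fun k => (hw k (hCmem k (hmem k)).1).1 _ (hlt k (hmem k)))
      (fun k => (hw k (hCmem k (hmem k)).1).1 _
        (C.min'_lt_of_mem_erase_min' hC k.2))
      (by
        intro k l hkl
        rcases lt_or_gt_of_ne hkl with h | h
        · exact ⟨E k, fun hiff => (hdist k l h).2 (hiff.2 (hdist k l h).1)⟩
        · exact ⟨E l, fun hiff => (hdist l k h).2 (hiff.1 (hdist l k h).1)⟩)
    rw [Fintype.card_coe, Finset.card_erase_of_mem hk₀] at hcard
    omega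
  · rw [Finset.not_nonempty_iff_eq_empty] at hC
    refine ⟨0, 1, by decide, ?_⟩
    rw [hC, Finset.card_empty] at hm1
    omega

end Chain

end WordEq

theorem mainTheorem2 (A : Type*) (m : ℕ) (hm : 0 < m) (E : Fin m → WordEq.Equation (Fin 3)) :
    ((WordEq.IsIndependent A E ∧ ∃ h ∈ WordEq.sysSol A E Set.univ, ¬ WordEq.IsPeriodic h) →
      ∃ x y : Fin 3, x ≠ y ∧ m ≤ ((E ⟨0, hm⟩).occ x + (E ⟨0, hm⟩).occ y) ^ 2 + 1) ∧
    (WordEq.IsChain A E →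
      ∃ x y : Fin 3, x ≠ y ∧ m ≤ ((E ⟨0, hm⟩).occ x + (E ⟨0, hm⟩).occ y) ^ 2 + 5) := by
  refine ⟨?_, fun hE => hE.length_le hm⟩
  rintro ⟨hE, h, hh, hp⟩
  simpa using hE.card_le hp (fun i => hh i trivial) ⟨0, hm⟩
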